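/- **Setting.** $Ty_n$ is the classical extensional higher-order logic $Q_0$ with primitive types $t$ (truth values) and $e_1,\dots,e_n$ (individuals), functional types $\alpha\beta$ (from $\alpha$ to $\beta$) and product types $\alpha\times\beta$, with pairs and projections, a description operator for each individual type, and arbitrary non-logical constants of any types. Terms may have free variables and are taken up to renaming of bound variables. Write $s=e_n$. Given a finite alphabet $\mathcal A=\{a_1,\dots,a_N\}$, the theory $Ty_n^{\mathcal A}$ has, among its constants, distinct constants $\mathbf C^0_s,\mathbf C^1_s,\dots,\mathbf C^N_s$ and $+_{sss}$, and the non-logical axioms $$\forall x_s\,(x_s+\mathbf C^0_s=x_s\ \wedge\ \mathbf C^0_s+x_s=x_s),\qquad \forall x_s\forall y_s\forall z_s\,((x_s+y_s)+z_s=x_s+(y_s+z_s)),$$ $$\forall x_s\forall y_s\forall z_s\,(x_s+\mathbf C^i_s+y_s\neq x_s+\mathbf C^j_s+z_s)\quad(1\le i<j\le N).$$ $Ty_n^{\mathcal A+}$ is an extension of $Ty_n^{\mathcal A}$ by additional non-logical constants. For a set $\Delta$ of formulas, $\Delta\vdash\varphi$ means provability from the hypotheses $\Delta$ (variables free in the hypotheses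 used may not be generalized). For a word $w\in\mathcal A^*$ the term $T_A(w)$ of type $s$ is given by $T_A(\varepsilon)=\mathbf C^0_s$, $T_A(a_i)=\mathbf C^i_s$, and $T_A(a_iw)=\mathbf C^i_s+T_A(w)$ for $w\ne\varepsilon$. An *$\alpha$-language* is a set of pairs $(w,A_\alpha)$ of a word $w\in\mathcal A^*$ and a $Ty_n^{\mathcal A}$ term $A_\alpha$ of type $\alpha$. It is *logically closed* if $(w,B_\alpha)\in\mathcal L$, $(w,C_\alpha)\in\mathcal L$ and $\vdash A_\alpha=B_\alpha\vee A_\alpha=C_\alpha$ in $Ty_n^{\mathcal A}$ imply $(w,A_\alpha)\in\mathcal L$. The *logical join* of two $\alpha$-languages $\mathcal L,\mathcal K$ is the least logically closed $\alpha$-language that includes $\mathcal L\cup\mathcal K$. Let $\Delta$ be a set of $Ty_n^{\mathcal A+}$ formulas and $L_{s\alpha t}$ a $Ty_n^{\mathcal A+}$ term. An $\alpha$-language $\mathcal L$ is *represented by* $(\Delta,L_{s\alpha t})$ if $\Delta$ is consistent and, for every word $w$ and every $Ty_n^{\mathcal A}$ term $A_\alpha$, $$(w,A_\alpha)\in\mathcal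 L\iff\Delta\vdash L_{s\alpha t}\,T_A(w)\,A_\alpha .$$ This representation is *pseudo-canonic* if moreover 1. for every word $w$ there are finitely many (possibly zero) $Ty_n^{\mathcal A}$ terms $A^1_\alpha,\dots,A^l_\alpha$ with $\Delta\vdash L_{s\alpha t}\,T_A(w)=\bigvee_{i=1}^{l}(=A^i_\alpha)$, and 2. $\Delta$ is conservative over $Ty_n^{\mathcal A}$: for every $Ty_n^{\mathcal A}$ formula $A_t$, $\ \vdash A_t$ in $Ty_n^{\mathcal A}$ if and only if $\Delta\vdash A_t$. Here $(=A_\alpha)$ is $\lambda x_\alpha(x_\alpha=A_\alpha)$ with $x_\alpha$ not free in $A_\alpha$; for terms of type $\alpha t$ the disjunction is pointwise, $P\vee Q=\lambda x_\alpha(P\,x_\alpha\vee Q\,x_\alpha)$, and the empty disjunction is $\lambda x_\alpha F$, where $F$ denotes falsehood. **Proposition 7.6.** Let $\alpha$-languages $\mathcal L$ and $\mathcal K$ have pseudo-canonic representations $(\Delta,L_{s\alpha t})$ and $(\Delta,K_{s\alpha t})$ respectively, with the same $\Delta$. Then their logical join is represented by $(\Delta,\,L_{s\alpha t}\vee K_{s\alpha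 t})$, where $L_{s\alpha t}\vee K_{s\alpha t}=\lambda x_s\lambda x_\alpha(L_{s\alpha t}\,x_s\,x_\alpha\vee K_{s\alpha t}\,x_s\,x_\alpha)$ with bound variables not free in $L_{s\alpha t}$, $K_{s\alpha t}$, and this representation is again pseudo-canonic. -/

import Mathlib

namespace TyN

universe u v

/-- Types over `n` sorts of individuals: the truth type `t`, the individual types `e i`,
functional types `fn α β` (functions from `α` to `β`) and product types. -/
inductive Ty (n : ℕ) : Type
  | t : Ty n
  | e (i : Fin n) : Ty n
  | fn (α β : Ty n) : Ty n
  | prod (α β : Ty n) : Ty n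
  deriving DecidableEq

infixr:60 " ⇒ " => Ty.fn

/-- Terms over a family `C` of non-logical constants, up to renaming of bound variables.
For every type `α` there are variables `var α 0, var α 1, …`, which may occur free.
De Bruijn indices are kept separately for every type: in `lam α M` the variable `var α 0` of `M` is
the bound one, `var α (i + 1)` of `M` is the variable `var α i` of the surrounding scope, and the
variables of the types other than `α` are those of the surrounding scope.
`iota i` is the description operator of the individual type `e i`. -/
inductive Term {n : ℕ} (C : Ty n → Type u) : Ty n → Type u
  | var (α : Ty n) (i : ℕ) : Term C α
  | con {α : Ty n} (c : C α) : Term C α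
  | iota (i : Fin n) : Term C ((Ty.e i ⇒ Ty.t) ⇒ Ty.e i)
  | app {α β : Ty n} (F : Term C (α ⇒ β)) (A : Term C α) : Term C β
  | lam (α : Ty n) {β : Ty n} (M : Term C β) : Term C (α ⇒ β)
  | eq {α : Ty n} (A B : Term C α) : Term C Ty.t
  | pair {α β : Ty n} (A : Term C α) (B : Term C β) : Term C (Ty.prod α β)
  | fst {α β : Ty n} (P : Term C (Ty.prod α β)) : Term C α
  | snd {α β : Ty n} (P : Term C (Ty.prod α β)) : Term C β

/-- Formulas are the terms of type `t`. -/
abbrev Formula {n : ℕ} (C : Ty n → Type u) : Type u := Term C Ty.t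

/-! ### Renaming and substitution of free variables -/

/-- A renaming of variables, type by type, carried under a binder of type `α`. -/
def upRen {n : ℕ} (α : Ty n) (ρ : Ty n → ℕ → ℕ) : Ty n → ℕ → ℕ := fun β i =>
  if β = α then
    match i with
    | 0 => 0
    | j + 1 => ρ β j + 1
  else ρ β i

namespace Term

variable {n : ℕ} {C : Ty n → Type u} {C' : Ty n → Type v}

def rename : {α : Ty n} → (Ty n → ℕ → ℕ) → Term C α → Term C α
  | _, ρ, var α i => var α (ρ α i)
  | _, _, con c => con c
  | _, _, iota i => iota i
  | _, ρ, app F A => app (rename ρ F) (rename ρ A)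
  | _, ρ, lam α M => lam α (rename (upRen α ρ) M)
  | _, ρ, eq A B => eq (rename ρ A) (rename ρ B)
  | _, ρ, pair A B => pair (rename ρ A) (rename ρ B)
  | _, ρ, fst P => fst (rename ρ P)
  | _, ρ, snd P => snd (rename ρ P)

/-- The term `A`, placed under one more binder of type `α` whose variable is not free in `A`. -/
def shift (α : Ty n) {β : Ty n} (A : Term C β) : Term C β :=
  rename (fun γ i => if γ = α then i + 1 else i) A

/-- A substitution carried under a binder of type `α`. -/
def upSubst (α : Ty n) (σ : (β : Ty n) → ℕ → Term C β) : (β : Ty n) → ℕ → Term C β := fun β i =>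
  if β = α then
    match i with
    | 0 => var β 0
    | j + 1 => shift α (σ β j)
  else shift α (σ β i)

/-- Simultaneous capture-avoiding substitution for the free variables. -/
def subst : {α : Ty n} → ((β : Ty n) → ℕ → Term C β) → Term C α → Term C α
  | _, σ, var α i => σ α i
  | _, _, con c => con c
  | _, _, iota i => iota i
  | _, σ, app F A => app (subst σ F) (subst σ A)
  | _, σ, lam α M => lam α (subst (upSubst α σ) M)
  | _, σ, eq A B => eq (subst σ A) (subst σ B)
  | _, σ, pair A B => pair (subst σ A) (subst σ B)
  | _, σ, fst P => fst (subst σ P)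
  | _, σ, snd P => snd (subst σ P)

/-- The substitution that replaces the variable of a removed binder of type `α` by `B`. -/
def single {α : Ty n} (B : Term C α) : (β : Ty n) → ℕ → Term C β := fun β i =>
  if h : β = α then
    match i with
    | 0 => h ▸ B
    | j + 1 => var β j
  else var β i

/-- The body `M` of an abstraction of type `α`, with the bound variable replaced by `B`. -/
def inst {α β : Ty n} (M : Term C β) (B : Term C α) : Term C β :=
  subst (single B) M

/-- Replacement of the constants along a map of the families of constants. -/
def mapCon (f : (α : Ty n) → C α → C' α) : {α : Ty n} → Term C α → Term C' α
  | _, var α i => var α i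
  | α, con c => con (f α c)
  | _, iota i => iota i
  | _, app F A => app (mapCon f F) (mapCon f A)
  | _, lam α M => lam α (mapCon f M)
  | _, eq A B => eq (mapCon f A) (mapCon f B)
  | _, pair A B => pair (mapCon f A) (mapCon f B)
  | _, fst P => fst (mapCon f P)
  | _, snd P => snd (mapCon f P)

/-! ### Connectives and quantifiers, defined from equality and abstraction -/

/-- `T` is `(=) = (=)`, where `(=)` is `λ x_t λ y_t (x_t = y_t)`. -/
def tru : Formula C :=
  eq (lam Ty.t (lam Ty.t (eq (var Ty.t 1) (var Ty.t 0))))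
    (lam Ty.t (lam Ty.t (eq (var Ty.t 1) (var Ty.t 0))))

/-- `F` is `(λ x_t T) = (λ x_t x_t)`. -/
def fls : Formula C := eq (lam Ty.t tru) (lam Ty.t (var Ty.t 0))

/-- `∀ x_α M`, the body `M` having `var α 0` as the quantified variable. -/
def all (α : Ty n) (M : Formula C) : Formula C := eq (lam α tru) (lam α M)

/-- `λ x_t λ y_t ((λ g g T T) = (λ g g x_t y_t))`, with `g` of type `t t t`. -/
def conjOp : Term C (Ty.t ⇒ Ty.t ⇒ Ty.t) :=
  lam Ty.t (lam Ty.t (eq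
    (lam (Ty.t ⇒ Ty.t ⇒ Ty.t) (app (app (var (Ty.t ⇒ Ty.t ⇒ Ty.t) 0) tru) tru))
    (lam (Ty.t ⇒ Ty.t ⇒ Ty.t)
      (app (app (var (Ty.t ⇒ Ty.t ⇒ Ty.t) 0) (var Ty.t 1)) (var Ty.t 0)))))

def conj (A B : Formula C) : Formula C := app (app conjOp A) B

/-- `A ⊃ B` is `A = (A ∧ B)`. -/
def imp (A B : Formula C) : Formula C := eq A (conj A B)

/-- `¬ A` is `F = A`. -/
def neg (A : Formula C) : Formula C := eq fls A

/-- `A ∨ B` is `¬ (¬ A ∧ ¬ B)`. -/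
def disj (A B : Formula C) : Formula C := neg (conj (neg A) (neg B))

/-- The shortcut `A ∨ B` for terms of type `α t`: the term `λ x_α (A x_α ∨ B x_α)`. -/
def disj₁ {α : Ty n} (A B : Term C (α ⇒ Ty.t)) : Term C (α ⇒ Ty.t) :=
  lam α (disj (app (shift α A) (var α 0)) (app (shift α B) (var α 0)))

/-- The same shortcut for terms of type `α β t`: the term `λ x_α (A x_α ∨ B x_α)`. -/
def disj₂ {α β : Ty n} (A B : Term C (α ⇒ β ⇒ Ty.t)) : Term C (α ⇒ β ⇒ Ty.t) :=
  lam α (disj₁ (app (shift α A) (var α 0)) (app (shift α B) (var α 0)))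

/-- The section `(= A)`, that is, `λ x_α (x_α = A)`. -/
def eqTo {α : Ty n} (A : Term C α) : Term C (α ⇒ Ty.t) :=
  lam α (eq (var α 0) (shift α A))

/-- The disjunction of finitely many terms of type `α t`; the empty one is `λ x_α F`. -/
def bigDisj {α : Ty n} : List (Term C (α ⇒ Ty.t)) → Term C (α ⇒ Ty.t)
  | [] => lam α fls
  | [P] => P
  | P :: Q :: l => disj₁ P (bigDisj (Q :: l))

end Term

/-! ### Provability -/

open Term in
/-- `Prov Ax Δ φ`: the formula `φ` is provable from the hypotheses `Δ` in the extension of the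
theory by the non-logical axioms `Ax` (closed formulas). This is Andrews' system `Q₀` over several
sorts of individuals, with pairs. The axioms are given as schemata. The rule of replacement of
equals by equals is split into the congruence rules and `eq_mp`; in `lam_congr` the abstracted
variable must not be free in the hypotheses, which the shift of the hypotheses expresses. -/
inductive Prov {n : ℕ} {C : Ty n → Type u} (Ax : Set (Formula C)) :
    Set (Formula C) → Formula C → Prop
  | nonlogical {Δ : Set (Formula C)} {φ : Formula C} : φ ∈ Ax → Prov Ax Δ φ
  | hyp {Δ : Set (Formula C)} {φ : Formula C} : φ ∈ Δ → Prov Ax Δ φ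
  | eq_mp {Δ : Set (Formula C)} {φ ψ : Formula C} :
      Prov Ax Δ (eq φ ψ) → Prov Ax Δ φ → Prov Ax Δ ψ
  | refl {Δ : Set (Formula C)} {α : Ty n} (A : Term C α) : Prov Ax Δ (eq A A)
  | app_congr {Δ : Set (Formula C)} {α β : Ty n} {F G : Term C (α ⇒ β)} {A B : Term C α} :
      Prov Ax Δ (eq F G) → Prov Ax Δ (eq A B) → Prov Ax Δ (eq (app F A) (app G B))
  | lam_congr {Δ : Set (Formula C)} {α β : Ty n} {M N : Term C β} :
      Prov Ax (shift α '' Δ) (eq M N) → Prov Ax Δ (eq (lam α M) (lam α N))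
  | eq_congr {Δ : Set (Formula C)} {α : Ty n} {A A' B B' : Term C α} :
      Prov Ax Δ (eq A A') → Prov Ax Δ (eq B B') → Prov Ax Δ (eq (eq A B) (eq A' B'))
  | pair_congr {Δ : Set (Formula C)} {α β : Ty n} {A A' : Term C α} {B B' : Term C β} :
      Prov Ax Δ (eq A A') → Prov Ax Δ (eq B B') → Prov Ax Δ (eq (pair A B) (pair A' B'))
  | fst_congr {Δ : Set (Formula C)} {α β : Ty n} {P P' : Term C (Ty.prod α β)} :
      Prov Ax Δ (eq P P') → Prov Ax Δ (eq (fst P) (fst P'))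
  | snd_congr {Δ : Set (Formula C)} {α β : Ty n} {P P' : Term C (Ty.prod α β)} :
      Prov Ax Δ (eq P P') → Prov Ax Δ (eq (snd P) (snd P'))
  /-- `(G T ∧ G F) = ∀ x_t (G x_t)` -/
  | bool {Δ : Set (Formula C)} (G : Term C (Ty.t ⇒ Ty.t)) :
      Prov Ax Δ (eq (conj (app G tru) (app G fls)) (all Ty.t (app (shift Ty.t G) (var Ty.t 0))))
  /-- `A = B ⊃ H A = H B` -/
  | leibniz {Δ : Set (Formula C)} {α : Ty n} (H : Term C (α ⇒ Ty.t)) (A B : Term C α) :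
      Prov Ax Δ (imp (eq A B) (eq (app H A) (app H B)))
  /-- `(F = G) = ∀ x_α (F x_α = G x_α)` -/
  | funext {Δ : Set (Formula C)} {α β : Ty n} (F G : Term C (α ⇒ β)) :
      Prov Ax Δ (eq (eq F G)
        (all α (eq (app (shift α F) (var α 0)) (app (shift α G) (var α 0)))))
  /-- `(λ x_α M) B = M(B)` -/
  | beta {Δ : Set (Formula C)} {α β : Ty n} (M : Term C β) (B : Term C α) :
      Prov Ax Δ (eq (app (lam α M) B) (inst M B))
  /-- `ι (λ x (A = x)) = A` for every individual type -/
  | descr {Δ : Set (Formula C)} {i : Fin n} (A : Term C (Ty.e i)) :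
      Prov Ax Δ (eq (app (iota i) (lam (Ty.e i) (eq (shift (Ty.e i) A) (var (Ty.e i) 0)))) A)
  | fst_pair {Δ : Set (Formula C)} {α β : Ty n} (A : Term C α) (B : Term C β) :
      Prov Ax Δ (eq (fst (pair A B)) A)
  | snd_pair {Δ : Set (Formula C)} {α β : Ty n} (A : Term C α) (B : Term C β) :
      Prov Ax Δ (eq (snd (pair A B)) B)
  | pair_eta {Δ : Set (Formula C)} {α β : Ty n} (P : Term C (Ty.prod α β)) :
      Prov Ax Δ (eq (pair (fst P) (snd P)) P)

/-! ### The symbolic type: the theories with an alphabet of `N` letters -/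

/-- The symbolic type: the last of the individual types. -/
def Ty.s {n : ℕ} : Ty (n + 1) := Ty.e (Fin.last n)

/-- The constants of the theory with an alphabet of `N` letters: a constant for the empty word, one
for each letter, the concatenation, and the arbitrary constants of the family `B`. -/
inductive SymCon {n : ℕ} (N : ℕ) (B : Ty (n + 1) → Type u) : Ty (n + 1) → Type u
  | empty : SymCon N B Ty.s
  | letter (i : Fin N) : SymCon N B Ty.s
  | cat : SymCon N B (Ty.s ⇒ Ty.s ⇒ Ty.s)
  | other {α : Ty (n + 1)} (c : B α) : SymCon N B α

section Symbolic

variable {n N : ℕ} {B : Ty (n + 1) → Type u}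

open Term

/-- The constant of the empty word. -/
def emptyT : Term (SymCon N B) Ty.s := con SymCon.empty

/-- The constant of the letter number `i`. -/
def letterT (i : Fin N) : Term (SymCon N B) Ty.s := con (SymCon.letter i)

/-- The concatenation `x + y`. -/
def catT (x y : Term (SymCon N B) Ty.s) : Term (SymCon N B) Ty.s :=
  app (app (con SymCon.cat) x) y

/-- The non-logical axioms of the symbolic type. -/
inductive SymAx : Formula (SymCon N B) → Prop
  /-- `∀ x (x + ε = x ∧ ε + x = x)` -/
  | unit : SymAx (all Ty.s (conj
      (eq (catT (var Ty.s 0) emptyT) (var Ty.s 0))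
      (eq (catT emptyT (var Ty.s 0)) (var Ty.s 0))))
  /-- `∀ x ∀ y ∀ z ((x + y) + z = x + (y + z))` -/
  | assoc : SymAx (all Ty.s (all Ty.s (all Ty.s (eq
      (catT (catT (var Ty.s 2) (var Ty.s 1)) (var Ty.s 0))
      (catT (var Ty.s 2) (catT (var Ty.s 1) (var Ty.s 0)))))))
  /-- `∀ x ∀ y ∀ z (x + aᵢ + y ≠ x + aⱼ + z)` for `i < j` -/
  | distinct (i j : Fin N) (hij : i < j) : SymAx (all Ty.s (all Ty.s (all Ty.s (neg (eq
      (catT (catT (var Ty.s 2) (letterT i)) (var Ty.s 1))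
      (catT (catT (var Ty.s 2) (letterT j)) (var Ty.s 0)))))))

/-- `Δ ⊢ φ` in the theory with the symbolic type and the further constants `B`. -/
def Provable (Δ : Set (Formula (SymCon N B))) (φ : Formula (SymCon N B)) : Prop :=
  Prov {ψ | SymAx ψ} Δ φ

def Consistent (Δ : Set (Formula (SymCon N B))) : Prop := ¬ Provable Δ fls

/-- The term that stands for a word: the concatenation of the constants of its letters. -/
def wordT : List (Fin N) → Term (SymCon N B) Ty.s
  | [] => emptyT
  | [a] => letterT a
  | a :: b :: w => catT (letterT a) (wordT (b :: w))

/-! ### Logically closed languages -/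

/-- An `α`-language: a set of pairs of a word and a term of type `α`. -/
abbrev Lang (N : ℕ) (B : Ty (n + 1) → Type u) (α : Ty (n + 1)) : Type u :=
  Set (List (Fin N) × Term (SymCon N B) α)

def LogicallyClosed {α : Ty (n + 1)} (L : Lang N B α) : Prop :=
  ∀ (w : List (Fin N)) (A A₁ A₂ : Term (SymCon N B) α), (w, A₁) ∈ L → (w, A₂) ∈ L →
    Provable ∅ (disj (eq A A₁) (eq A A₂)) → (w, A) ∈ L

/-- The least logically closed language that includes `L`. -/
def logicalClosure {α : Ty (n + 1)} (L : Lang N B α) : Lang N B α :=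
  ⋂₀ {M | L ⊆ M ∧ LogicallyClosed M}

/-- The logical join of two languages. -/
def logicalJoin {α : Ty (n + 1)} (L K : Lang N B α) : Lang N B α := logicalClosure (L ∪ K)

/-! ### Representations in an extension by new constants -/

variable {D : Ty (n + 1) → Type v}

/-- The inclusion of the constants of a theory into those of its extension by new constants `D`. -/
def extCon (D : Ty (n + 1) → Type v) (α : Ty (n + 1)) :
    SymCon N B α → SymCon N (fun β => B β ⊕ D β) α
  | .empty => .empty
  | .letter i => .letter i
  | .cat => .cat
  | .other c => .other (Sum.inl c)

/-- A term, read as a term of the extension by new constants `D`. -/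
def ext (D : Ty (n + 1) → Type v) {α : Ty (n + 1)} (A : Term (SymCon N B) α) :
    Term (SymCon N (fun β => B β ⊕ D β)) α :=
  mapCon (extCon D) A

/-- The language `L` is represented by `(Δ, T)`, where `Δ` and `T` belong to the extension of the
theory by the new constants `D`. -/
def Represents {α : Ty (n + 1)} (Δ : Set (Formula (SymCon N (fun β => B β ⊕ D β))))
    (T : Term (SymCon N (fun β => B β ⊕ D β)) (Ty.s ⇒ α ⇒ Ty.t)) (L : Lang N B α) : Prop :=
  Consistent Δ ∧ ∀ (w : List (Fin N)) (A : Term (SymCon N B) α),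
    (w, A) ∈ L ↔ Provable Δ (app (app T (wordT w)) (ext D A))

/-- The extension by the new constants `D` and the new axioms `Δ` is conservative. -/
def Conservative (Δ : Set (Formula (SymCon N (fun β => B β ⊕ D β)))) : Prop :=
  ∀ φ : Formula (SymCon N B), Provable ∅ φ ↔ Provable Δ (ext D φ)

/-- `(Δ, T)` is a pseudo-canonic representation of the language `L`. -/
def PseudoCanonic {α : Ty (n + 1)} (Δ : Set (Formula (SymCon N (fun β => B β ⊕ D β))))
    (T : Term (SymCon N (fun β => B β ⊕ D β)) (Ty.s ⇒ α ⇒ Ty.t)) (L : Lang N B α) : Prop :=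
  Represents Δ T L ∧
  (∀ w : List (Fin N), ∃ l : List (Term (SymCon N B) α),
    Provable Δ (eq (app T (wordT w)) (bigDisj (l.map fun A => eqTo (ext D A))))) ∧
  Conservative Δ

end Symbolic

end TyN

/-!
By conservativity, the terms that a pseudo-canonic representation assigns to a word `w` are exactly
the terms `A` with `⊢ A = A¹ ∨ … ∨ A = Aˡ` in the theory without `Δ`. For `L ∨ K` the lists of the
two representations are concatenated, so the point is that a logically closed language that contains
`A¹, …, Aˡ` at `w` contains every such `A`. Logical closure speaks of two terms only. For `l ≥ 2`,
let `A'` be the term `if A = A¹ then A² else A`. It is provably one of `A², …, Aˡ`, hence in the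
language by induction, and `⊢ A = A¹ ∨ A = A'`. Conditional terms are available at every type,
by description at the individual types, pointwise at the functional types and componentwise at the
product types.
-/

namespace TyN

universe u v w

/-! ### Substitution -/

namespace Term

variable {n : ℕ} {C : Ty n → Type u} {α β γ : Ty n}
  (ρ ρ' : Ty n → ℕ → ℕ) (σ : (γ : Ty n) → ℕ → Term C γ)

attribute [simp] rename subst

@[simp] theorem upRen_zero : upRen α ρ α 0 = 0 := by simp [upRen]

@[simp] theorem upRen_succ (i : ℕ) : upRen α ρ α (i + 1) = ρ α i + 1 := by simp [upRen]

@[simp] theorem upRen_of_ne (h : γ ≠ α) (i : ℕ) : upRen α ρ γ i = ρ γ i := by simp [upRen, h]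

@[simp] theorem upSubst_zero : upSubst α σ α 0 = var α 0 := by simp [upSubst]

@[simp] theorem upSubst_succ (i : ℕ) : upSubst α σ α (i + 1) = shift α (σ α i) := by simp [upSubst]

@[simp] theorem upSubst_of_ne (h : γ ≠ α) (i : ℕ) : upSubst α σ γ i = shift α (σ γ i) := by
  simp [upSubst, h]

@[simp] theorem single_zero (B : Term C α) : single B α 0 = B := by simp [single]

@[simp] theorem single_succ (B : Term C α) (i : ℕ) : single B α (i + 1) = var α i := by
  simp [single]

@[simp] theorem single_of_ne (B : Term C α) (h : γ ≠ α) (i : ℕ) : single B γ i = var γ i := by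
  simp [single, h]

@[simp] theorem shift_var_self (i : ℕ) : shift α (var α i : Term C α) = var α (i + 1) := by
  simp [shift]

@[simp] theorem shift_var_of_ne (h : γ ≠ α) (i : ℕ) :
    shift α (var γ i : Term C γ) = var γ i := by
  simp [shift, h]

theorem upSubst_var : upSubst α var = (var : (γ : Ty n) → ℕ → Term C γ) := by
  funext γ i
  obtain rfl | h := eq_or_ne γ α
  · cases i <;> simp
  · simp [h]

theorem upSubst_var_comp :
    upSubst α (fun γ i => (var γ (ρ γ i) : Term C γ)) = fun γ i => var γ (upRen α ρ γ i) := by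
  funext γ i
  obtain rfl | h := eq_or_ne γ α
  · cases i <;> simp
  · simp [h]

theorem upSubst_comp_upRen :
    (fun γ i => upSubst α σ γ (upRen α ρ γ i)) = upSubst α fun γ i => σ γ (ρ γ i) := by
  funext γ i
  obtain rfl | h := eq_or_ne γ α
  · cases i <;> simp
  · simp [h]

@[simp] theorem subst_var (A : Term C α) : subst var A = A := by
  induction A with
  | lam α M ih => rw [subst, upSubst_var, ih]
  | _ => simp_all

theorem rename_eq_subst (A : Term C α) : rename ρ A = subst (fun γ i => var γ (ρ γ i)) A := by
  induction A generalizing ρ with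
  | lam α M ih => rw [rename, subst, ih, upSubst_var_comp]
  | _ => simp_all

theorem subst_rename (A : Term C α) :
    subst σ (rename ρ A) = subst (fun γ i => σ γ (ρ γ i)) A := by
  induction A generalizing σ ρ with
  | lam α M ih => rw [rename, subst, subst, ih, upSubst_comp_upRen]
  | _ => simp_all

theorem rename_rename (A : Term C α) :
    rename ρ (rename ρ' A) = rename (fun γ i => ρ γ (ρ' γ i)) A := by
  rw [rename_eq_subst, subst_rename, ← rename_eq_subst]

theorem rename_upRen_shift (A : Term C β) :
    rename (upRen α ρ) (shift α A) = shift α (rename ρ A) := by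
  simp only [shift, rename_rename]
  congr! 3 with γ i
  obtain rfl | h := eq_or_ne γ α <;> simp [*]

theorem rename_upSubst :
    (fun γ i => rename (upRen α ρ) (upSubst α σ γ i)) = upSubst α fun γ i => rename ρ (σ γ i) := by
  funext γ i
  obtain rfl | h := eq_or_ne γ α
  · cases i <;> simp [rename_upRen_shift]
  · simp [h, rename_upRen_shift]

theorem rename_subst (A : Term C α) :
    rename ρ (subst σ A) = subst (fun γ i => rename ρ (σ γ i)) A := by
  induction A generalizing σ ρ with
  | lam α M ih => rw [subst, rename, subst, ih, rename_upSubst]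
  | _ => simp_all

@[simp] theorem subst_upSubst_shift (A : Term C β) :
    subst (upSubst α σ) (shift α A) = shift α (subst σ A) := by
  rw [shift, shift, subst_rename, rename_subst]
  congr! 3 with γ i
  obtain rfl | h := eq_or_ne γ α <;> simp [shift, *]

@[simp] theorem subst_single_shift (A : Term C β) (B : Term C α) :
    subst (single B) (shift α A) = A := by
  rw [shift, subst_rename]
  convert subst_var A with γ i
  obtain rfl | h := eq_or_ne γ α <;> simp [*]

theorem inst_rename_upRen_var (M : Term C β) :
    inst (rename (upRen α fun γ i => if γ = α then i + 1 else i) M) (var α 0) = M := by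
  rw [inst, subst_rename]
  convert subst_var M with γ i
  obtain rfl | h := eq_or_ne γ α
  · cases i <;> simp
  · simp [h]

@[simp] theorem subst_tru : subst σ tru = tru := by simp [tru]

@[simp] theorem subst_fls : subst σ fls = fls := by simp [fls]

@[simp] theorem subst_conj (A B : Formula C) :
    subst σ (conj A B) = conj (subst σ A) (subst σ B) := by
  simp [conj, conjOp]

@[simp] theorem subst_imp (A B : Formula C) :
    subst σ (imp A B) = imp (subst σ A) (subst σ B) := by
  simp [imp]

@[simp] theorem subst_neg (A : Formula C) : subst σ (neg A) = neg (subst σ A) := by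
  simp [neg]

@[simp] theorem subst_disj (A B : Formula C) :
    subst σ (disj A B) = disj (subst σ A) (subst σ B) := by
  simp [disj]

@[simp] theorem subst_disj₁ (A B : Term C (α ⇒ Ty.t)) :
    subst σ (disj₁ A B) = disj₁ (subst σ A) (subst σ B) := by
  simp [disj₁]

@[simp] theorem shift_tru : shift α (tru : Formula C) = tru := by
  simp [shift, rename_eq_subst]

@[simp] theorem shift_fls : shift α (fls : Formula C) = fls := by
  simp [shift, rename_eq_subst]

@[simp] theorem shift_disj₁ (A B : Term C (β ⇒ Ty.t)) :
    shift α (disj₁ A B) = disj₁ (shift α A) (shift α B) := by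
  simp [shift, rename_eq_subst]

end Term

open Term

/-! ### Equality, truth values and quantifiers -/

namespace Prov

variable {n : ℕ} {C : Ty n → Type u} {Ax Δ : Set (Formula C)} {α β : Ty n}

theorem symm {A B : Term C α} (h : Prov Ax Δ (eq A B)) : Prov Ax Δ (eq B A) :=
  eq_mp (eq_congr h (refl A)) (refl A)

theorem trans {A₁ A₂ A₃ : Term C α} (h : Prov Ax Δ (eq A₁ A₂)) (h' : Prov Ax Δ (eq A₂ A₃)) :
    Prov Ax Δ (eq A₁ A₃) :=
  eq_mp (eq_congr (refl A₁) h') h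

theorem eq_mpr {φ ψ : Formula C} (h : Prov Ax Δ (eq φ ψ)) (h' : Prov Ax Δ ψ) : Prov Ax Δ φ :=
  eq_mp h.symm h'

theorem app_congr_left {F G : Term C (α ⇒ β)} (h : Prov Ax Δ (eq F G)) (A : Term C α) :
    Prov Ax Δ (eq (app F A) (app G A)) :=
  app_congr h (refl A)

theorem app_congr_right (F : Term C (α ⇒ β)) {A B : Term C α} (h : Prov Ax Δ (eq A B)) :
    Prov Ax Δ (eq (app F A) (app F B)) :=
  app_congr (refl F) h

theorem conj_congr {A A' B B' : Formula C} (h : Prov Ax Δ (eq A A')) (h' : Prov Ax Δ (eq B B')) :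
    Prov Ax Δ (eq (conj A B) (conj A' B')) :=
  app_congr (app_congr_right _ h) h'

theorem disj_congr {A A' B B' : Formula C} (h : Prov Ax Δ (eq A A')) (h' : Prov Ax Δ (eq B B')) :
    Prov Ax Δ (eq (disj A B) (disj A' B')) :=
  eq_congr (refl _) (conj_congr (eq_congr (refl _) h) (eq_congr (refl _) h'))

theorem beta_of_inst_eq {M : Term C β} {B : Term C α} {A : Term C β} (h : inst M B = A) :
    Prov Ax Δ (eq (app (lam α M) B) A) := h ▸ beta M B

theorem beta_shift (M : Term C β) : Prov Ax Δ (eq (app (shift α (lam α M)) (var α 0)) M) :=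
  beta_of_inst_eq (inst_rename_upRen_var M)

theorem truth : Prov Ax Δ tru := refl _

theorem tru_eq_inst {M : Formula C} (h : Prov Ax Δ (all α M)) (B : Term C α) :
    Prov Ax Δ (eq tru (inst M B)) :=
  (beta_of_inst_eq (by simp [inst])).symm.trans ((app_congr_left h B).trans (beta M B))

theorem all_elim {M : Formula C} (h : Prov Ax Δ (all α M)) (B : Term C α) :
    Prov Ax Δ (inst M B) :=
  eq_mp (tru_eq_inst h B) truth

theorem funext_lam (M N : Term C β) :
    Prov Ax Δ (eq (eq (lam α M) (lam α N)) (all α (eq M N))) :=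
  (funext _ _).trans (eq_congr (refl _) (lam_congr (eq_congr (beta_shift M) (beta_shift N))))

theorem tru_eq_refl (A : Term C α) : Prov Ax Δ (eq tru (eq A A)) := by
  have h : Prov Ax Δ (all α (eq (var α 0) (var α 0))) := eq_mp (funext_lam _ _) (refl _)
  simpa [inst] using tru_eq_inst h A

theorem tru_eq_eq {A B : Term C α} (h : Prov Ax Δ (eq A B)) : Prov Ax Δ (eq tru (eq A B)) :=
  (tru_eq_refl A).trans (eq_congr (refl A) h)

theorem conj_eq (A B : Formula C) : Prov Ax Δ (eq (conj A B)
    (eq (lam (Ty.t ⇒ Ty.t ⇒ Ty.t) (app (app (var (Ty.t ⇒ Ty.t ⇒ Ty.t) 0) tru) tru))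
      (lam (Ty.t ⇒ Ty.t ⇒ Ty.t)
        (app (app (var (Ty.t ⇒ Ty.t ⇒ Ty.t) 0) (shift (Ty.t ⇒ Ty.t ⇒ Ty.t) A))
          (shift (Ty.t ⇒ Ty.t ⇒ Ty.t) B))))) :=
  (app_congr_left (beta _ A) B).trans (beta_of_inst_eq (by simp [inst]))

theorem conj_tru_tru : Prov Ax Δ (eq (conj tru tru) tru) :=
  (conj_eq _ _).trans (by simpa using (tru_eq_refl _).symm)

theorem conj_of_tru_eq {A B : Formula C} (h : Prov Ax Δ (eq tru A)) (h' : Prov Ax Δ (eq tru B)) :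
    Prov Ax Δ (conj A B) :=
  eq_mp (conj_congr h h') (eq_mpr conj_tru_tru truth)

theorem bool_inst (M : Formula C) :
    Prov Ax Δ (eq (conj (inst M tru) (inst M fls)) (all Ty.t M)) :=
  (conj_congr (beta M tru) (beta M fls)).symm.trans ((bool (lam Ty.t M)).trans
    (eq_congr (refl _) (lam_congr (beta_shift M))))

theorem conj_tru_fls : Prov Ax Δ (eq (conj tru fls) fls) := by
  have h : Prov Ax Δ (eq (conj tru fls) (all Ty.t (var Ty.t 0))) := by
    simpa [inst] using bool_inst (var Ty.t 0)
  exact h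

theorem inst_eq_inst_of_bool {M N : Term C α} (A : Formula C)
    (ht : Prov Ax Δ (eq (inst M tru) (inst N tru)))
    (hf : Prov Ax Δ (eq (inst M fls) (inst N fls))) :
    Prov Ax Δ (eq (inst M A) (inst N A)) :=
  all_elim (M := eq M N)
    (eq_mp (bool_inst (eq M N)) (conj_of_tru_eq (tru_eq_eq ht) (tru_eq_eq hf))) A

theorem tru_conj (A : Formula C) : Prov Ax Δ (eq (conj tru A) A) := by
  simpa [inst] using inst_eq_inst_of_bool (M := conj tru (var Ty.t 0)) (N := var Ty.t 0) A
    (by simpa [inst] using conj_tru_tru) (by simpa [inst] using conj_tru_fls)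

-- Both sides of `(T = T) ∧ (T = F) = ∀ x_t (T = x_t)` simplify: the left one to `T = F`, the right
-- one, by extensionality, to `(λ x_t T) = (λ x_t x_t)`, which is `F`.
theorem tru_eq_fls : Prov Ax Δ (eq (eq tru fls) fls) := by
  have hbool : Prov Ax Δ
      (eq (conj (eq tru tru) (eq tru fls)) (all Ty.t (eq tru (var Ty.t 0)))) := by
    simpa [inst] using bool_inst (eq tru (var Ty.t 0))
  have hleft : Prov Ax Δ (eq (conj (eq tru tru) (eq tru fls)) (eq tru fls)) :=
    (conj_congr (tru_eq_refl tru).symm (refl _)).trans (tru_conj _)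
  have hright : Prov Ax Δ (eq fls (all Ty.t (eq tru (var Ty.t 0)))) := funext_lam _ _
  exact hleft.symm.trans (hbool.trans hright.symm)

theorem tru_eq (A : Formula C) : Prov Ax Δ (eq (eq tru A) A) := by
  simpa [inst] using inst_eq_inst_of_bool (M := eq tru (var Ty.t 0)) (N := var Ty.t 0) A
    (by simpa [inst] using (tru_eq_refl tru).symm) (by simpa [inst] using tru_eq_fls)

theorem tru_eq_of {A : Formula C} (h : Prov Ax Δ A) : Prov Ax Δ (eq tru A) :=
  eq_mpr (tru_eq A) h

theorem conj_intro {A B : Formula C} (h : Prov Ax Δ A) (h' : Prov Ax Δ B) : Prov Ax Δ (conj A B) :=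
  conj_of_tru_eq (tru_eq_of h) (tru_eq_of h')

theorem mp {A B : Formula C} (h : Prov Ax Δ (imp A B)) (h' : Prov Ax Δ A) : Prov Ax Δ B :=
  eq_mp ((conj_congr (tru_eq_of h').symm (refl B)).trans (tru_conj B)) (eq_mp h h')

theorem all_intro {M : Formula C} (h : Prov Ax (shift α '' Δ) M) : Prov Ax Δ (all α M) :=
  lam_congr (tru_eq_of h)

theorem ext {F G : Term C (α ⇒ β)}
    (h : Prov Ax (shift α '' Δ) (eq (app (shift α F) (var α 0)) (app (shift α G) (var α 0)))) :
    Prov Ax Δ (eq F G) :=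
  eq_mpr (funext F G) (all_intro h)

theorem eta (F : Term C (α ⇒ β)) : Prov Ax Δ (eq (lam α (app (shift α F) (var α 0))) F) :=
  ext (beta_shift _)

theorem inst_of_bool {M : Formula C} (A : Formula C) (ht : Prov Ax Δ (inst M tru))
    (hf : Prov Ax Δ (inst M fls)) : Prov Ax Δ (inst M A) :=
  all_elim (eq_mp (bool_inst M) (conj_intro ht hf)) A

-- Leibniz's law for `λ x_t M` at `T` and `F` says `(T = F) ⊃ (M(T) = M(F))`, with `T = F` equal to
-- `F` and, if `M(T)` is `T`, with `M(T) = M(F)` equal to `M(F)`.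
theorem fls_conj_inst {M : Formula C} (h : Prov Ax Δ (eq (inst M tru) tru)) :
    Prov Ax Δ (eq (conj fls (inst M fls)) fls) := by
  have hM : Prov Ax Δ (eq (eq (app (lam Ty.t M) tru) (app (lam Ty.t M) fls)) (inst M fls)) :=
    (eq_congr ((beta M tru).trans h) (beta M fls)).trans (tru_eq _)
  have hleibniz : Prov Ax Δ (eq (eq tru fls) (conj (eq tru fls) _)) :=
    leibniz (lam Ty.t M) tru fls
  exact (tru_eq_fls.symm.trans (hleibniz.trans (conj_congr tru_eq_fls hM))).symm

theorem conj_fls_tru : Prov Ax Δ (eq (conj fls tru) fls) := by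
  simpa [inst] using fls_conj_inst (M := tru) (by simpa [inst] using refl tru)

theorem conj_fls_fls : Prov Ax Δ (eq (conj fls fls) fls) := by
  simpa [inst] using fls_conj_inst (M := var Ty.t 0) (by simpa [inst] using refl tru)

theorem conj_fls (A : Formula C) : Prov Ax Δ (eq (conj A fls) fls) := by
  simpa [inst] using inst_eq_inst_of_bool (M := conj (var Ty.t 0) fls) (N := fls) A
    (by simpa [inst] using conj_tru_fls) (by simpa [inst] using conj_fls_fls)

theorem fls_eq_tru : Prov Ax Δ (eq (eq fls tru) fls) := by
  let H : Term C (Ty.t ⇒ Ty.t) := lam Ty.t (eq (var Ty.t 0) fls)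
  have hleibniz : Prov Ax Δ (eq (eq fls tru) (conj (eq fls tru) (eq (app H fls) (app H tru)))) :=
    leibniz H fls tru
  have hfls : Prov Ax Δ (eq (app H fls) tru) :=
    (beta_of_inst_eq (by simp [inst])).trans (tru_eq_refl fls).symm
  have htru : Prov Ax Δ (eq (app H tru) fls) :=
    (beta_of_inst_eq (by simp [inst])).trans tru_eq_fls
  have hH : Prov Ax Δ (eq (eq (app H fls) (app H tru)) fls) :=
    (eq_congr hfls htru).trans tru_eq_fls
  exact hleibniz.trans ((conj_congr (refl _) hH).trans (conj_fls _))

end Prov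

/-! ### Tautologies -/

/-- Propositional formulas with atoms in `ι`. They index the tautologies of the logic; the
connectives that `Term` defines from others are defined here in the same way. -/
inductive PropForm (ι : Type w) : Type w
  | atom (i : ι) : PropForm ι
  | tru : PropForm ι
  | fls : PropForm ι
  | iff (P Q : PropForm ι) : PropForm ι
  | conj (P Q : PropForm ι) : PropForm ι

namespace PropForm

variable {ι : Type w}

/-- The implication `P ⊃ Q`, encoded as `Term.imp` is. -/
def imp (P Q : PropForm ι) : PropForm ι := iff P (conj P Q)

/-- The negation `¬ P`, encoded as `Term.neg` is. -/
def neg (P : PropForm ι) : PropForm ι := iff fls P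

/-- The disjunction `P ∨ Q`, encoded as `Term.disj` is. -/
def disj (P Q : PropForm ι) : PropForm ι := neg (conj (neg P) (neg Q))

/-- The truth value under an assignment of truth values to the atoms. -/
def eval (b : ι → Bool) : PropForm ι → Bool
  | atom i => b i
  | tru => true
  | fls => false
  | iff P Q => P.eval b == Q.eval b
  | conj P Q => P.eval b && Q.eval b

variable {n : ℕ} {C : Ty n → Type u} {Ax Δ : Set (Formula C)}

/-- The instance of a propositional formula with the formulas `v i` for the atoms. -/
def interp (v : ι → Formula C) : PropForm ι → Formula C
  | atom i => v i
  | tru => Term.tru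
  | fls => Term.fls
  | iff P Q => Term.eq (P.interp v) (Q.interp v)
  | conj P Q => Term.conj (P.interp v) (Q.interp v)

/-- The formula `T` or `F` that denotes a truth value. -/
def ofBool : Bool → Formula C
  | true => Term.tru
  | false => Term.fls

theorem subst_interp (σ : (γ : Ty n) → ℕ → Term C γ) (v : ι → Formula C) (P : PropForm ι) :
    subst σ (P.interp v) = P.interp fun i => subst σ (v i) := by
  induction P with
  | _ => simp_all [interp]

theorem prov_interp_ofBool (b : ι → Bool) (P : PropForm ι) :
    Prov Ax Δ (eq (P.interp fun i => ofBool (b i)) (ofBool (P.eval b))) := by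
  induction P with
  | iff P Q hP hQ =>
    refine (Prov.eq_congr hP hQ).trans ?_
    rw [eval]
    cases P.eval b <;> cases Q.eval b
    · exact (Prov.tru_eq_refl _).symm
    · exact Prov.fls_eq_tru
    · exact Prov.tru_eq_fls
    · exact (Prov.tru_eq_refl _).symm
  | conj P Q hP hQ =>
    refine (Prov.conj_congr hP hQ).trans ?_
    rw [eval]
    cases P.eval b <;> cases Q.eval b
    · exact Prov.conj_fls_fls
    · exact Prov.conj_fls_tru
    · exact Prov.conj_tru_fls
    · exact Prov.conj_tru_tru
  | _ => exact Prov.refl _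

theorem prov_interp_of_update [DecidableEq ι] {P : PropForm ι} {v : ι → Formula C} (i : ι)
    (h : ∀ b, Prov Ax Δ (P.interp (Function.update v i (ofBool b)))) :
    Prov Ax Δ (P.interp v) := by
  let M := P.interp (Function.update (fun j => shift Ty.t (v j)) i (var Ty.t 0))
  have hM (A : Formula C) : inst M A = P.interp (Function.update v i A) := by
    rw [inst, subst_interp]
    congr with j
    obtain rfl | hj := eq_or_ne j i <;> simp [*]
  have hv : Prov Ax Δ (inst M (v i)) :=
    Prov.inst_of_bool (v i) (hM _ ▸ h true) (hM _ ▸ h false)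
  rwa [hM, Function.update_eq_self] at hv

theorem prov_interp_of_finset {P : PropForm ι} (hP : ∀ b, P.eval b = true) (s : Finset ι)
    {v : ι → Formula C} (hv : ∀ i ∉ s, ∃ b, v i = ofBool b) : Prov Ax Δ (P.interp v) := by
  classical
  induction s using Finset.induction_on generalizing v with
  | empty =>
    choose b hb using fun i => hv i (Finset.notMem_empty i)
    obtain rfl : v = fun i => ofBool (b i) := funext hb
    refine Prov.eq_mpr (prov_interp_ofBool b P) ?_
    rw [hP]
    exact Prov.truth
  | insert i s _ ih =>
    refine prov_interp_of_update i fun b => ih fun j hj => ?_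
    obtain rfl | hji := eq_or_ne j i
    · exact ⟨b, by simp⟩
    · simpa [hji] using hv j (by simp [hji, hj])

end PropForm

theorem Prov.taut {n : ℕ} {C : Ty n → Type u} {Ax Δ : Set (Formula C)} {ι : Type w} [Finite ι]
    (P : PropForm ι) (v : ι → Formula C) (hP : ∀ b, P.eval b = true := by decide) :
    Prov Ax Δ (P.interp v) := by
  have := Fintype.ofFinite ι
  exact PropForm.prov_interp_of_finset hP Finset.univ fun i hi => absurd (Finset.mem_univ i) hi

/-! ### Conditional terms -/

namespace Term

variable {n : ℕ} {C : Ty n → Type u}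

/-- The formula `if p then A else B`. -/
def condFormula (p A B : Formula C) : Formula C := disj (conj p A) (conj (neg p) B)

/-- The term `if p then A else B`. There is no such operation among the primitives of the
logic, so it is built by recursion on the type: a description at the individual types, pointwise at
the functional types and componentwise at the product types. -/
def condTerm : {α : Ty n} → Formula C → Term C α → Term C α → Term C α
  | Ty.t, p, A, B => condFormula p A B
  | Ty.e i, p, A, B => app (iota i) (lam (Ty.e i) (condFormula (shift (Ty.e i) p)
      (eq (shift (Ty.e i) A) (var (Ty.e i) 0)) (eq (shift (Ty.e i) B) (var (Ty.e i) 0))))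
  | Ty.fn α _, p, A, B =>
      lam α (condTerm (shift α p) (app (shift α A) (var α 0)) (app (shift α B) (var α 0)))
  | Ty.prod _ _, p, A, B => pair (condTerm p (fst A) (fst B)) (condTerm p (snd A) (snd B))

@[simp] theorem subst_condFormula (σ : (γ : Ty n) → ℕ → Term C γ) (p A B : Formula C) :
    subst σ (condFormula p A B) = condFormula (subst σ p) (subst σ A) (subst σ B) := by
  simp [condFormula]

@[simp] theorem subst_condTerm (σ : (γ : Ty n) → ℕ → Term C γ) {α : Ty n} (p : Formula C)
    (A B : Term C α) : subst σ (condTerm p A B) = condTerm (subst σ p) (subst σ A) (subst σ B) := by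
  induction α generalizing σ p with
  | _ => simp_all [condTerm]

end Term

namespace Prov

variable {n : ℕ} {C : Ty n → Type u} {Ax Δ : Set (Formula C)} {α β : Ty n}

theorem condFormula_tru (A B : Formula C) : Prov Ax Δ (eq (condFormula tru A B) A) :=
  taut (.iff (.disj (.conj .tru (.atom 0)) (.conj (.neg .tru) (.atom 1))) (.atom 0)) ![A, B]

theorem condFormula_fls (A B : Formula C) : Prov Ax Δ (eq (condFormula fls A B) B) :=
  taut (.iff (.disj (.conj .fls (.atom 0)) (.conj (.neg .fls) (.atom 1))) (.atom 1)) ![A, B]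

theorem condTerm_tru (A B : Term C α) : Prov Ax Δ (eq (condTerm tru A B) A) := by
  induction α generalizing Δ with
  | t => exact condFormula_tru A B
  | e i =>
    rw [condTerm, shift_tru]
    exact (app_congr_right _ (lam_congr (condFormula_tru _ _))).trans (descr A)
  | fn α β _ ih =>
    rw [condTerm, shift_tru]
    exact (lam_congr (ih _ _)).trans (eta A)
  | prod α β ih ih' => exact (pair_congr (ih _ _) (ih' _ _)).trans (pair_eta A)

theorem condTerm_fls (A B : Term C α) : Prov Ax Δ (eq (condTerm fls A B) B) := by
  induction α generalizing Δ with
  | t => exact condFormula_fls A B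
  | e i =>
    rw [condTerm, shift_fls]
    exact (app_congr_right _ (lam_congr (condFormula_fls _ _))).trans (descr B)
  | fn α β _ ih =>
    rw [condTerm, shift_fls]
    exact (lam_congr (ih _ _)).trans (eta B)
  | prod α β ih ih' => exact (pair_congr (ih _ _) (ih' _ _)).trans (pair_eta B)

theorem imp_of_right (A : Formula C) {B : Formula C} (h : Prov Ax Δ B) : Prov Ax Δ (imp A B) :=
  mp (taut (.imp (.atom 1) (.imp (.atom 0) (.atom 1))) ![A, B]) h

theorem imp_of_eq {A B : Formula C} (h : Prov Ax Δ (eq A B)) : Prov Ax Δ (imp A B) :=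
  mp (taut (.imp (.iff (.atom 0) (.atom 1)) (.imp (.atom 0) (.atom 1))) ![A, B]) h

theorem disj_inl {A : Formula C} (B : Formula C) (h : Prov Ax Δ A) : Prov Ax Δ (disj A B) :=
  mp (taut (.imp (.atom 0) (.disj (.atom 0) (.atom 1))) ![A, B]) h

theorem disj_inr (A : Formula C) {B : Formula C} (h : Prov Ax Δ B) : Prov Ax Δ (disj A B) :=
  mp (taut (.imp (.atom 1) (.disj (.atom 0) (.atom 1))) ![A, B]) h

theorem disj_fls (A : Formula C) : Prov Ax Δ (eq (disj A fls) A) :=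
  taut (.iff (.disj (.atom 0) .fls) (.atom 0)) ![A]

theorem fls_disj (A : Formula C) : Prov Ax Δ (eq (disj fls A) A) :=
  taut (.iff (.disj .fls (.atom 0)) (.atom 0)) ![A]

theorem disj_assoc (A₁ A₂ A₃ : Formula C) :
    Prov Ax Δ (eq (disj (disj A₁ A₂) A₃) (disj A₁ (disj A₂ A₃))) :=
  taut (.iff (.disj (.disj (.atom 0) (.atom 1)) (.atom 2))
    (.disj (.atom 0) (.disj (.atom 1) (.atom 2)))) ![A₁, A₂, A₃]

theorem or_eq_condTerm (p : Formula C) (A B : Term C α) :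
    Prov Ax Δ (disj p (eq B (condTerm p A B))) := by
  simpa [inst] using inst_of_bool (Ax := Ax) (Δ := Δ)
    (M := disj (var Ty.t 0)
      (eq (shift Ty.t B) (condTerm (var Ty.t 0) (shift Ty.t A) (shift Ty.t B)))) p
    (by simpa [inst] using disj_inl _ truth)
    (by simpa [inst] using disj_inr _ (condTerm_fls A B).symm)

theorem app_condTerm {p : Formula C} {P : Term C (α ⇒ Ty.t)} {A B : Term C α}
    (hA : Prov Ax Δ (app P A)) (hB : Prov Ax Δ (disj p (app P B))) :
    Prov Ax Δ (app P (condTerm p A B)) := by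
  have htru : Prov Ax Δ (imp (disj tru (app P B)) (app P (condTerm tru A B))) :=
    imp_of_right _ (eq_mpr (app_congr_right P (condTerm_tru A B)) hA)
  have hfls : Prov Ax Δ (imp (disj fls (app P B)) (app P (condTerm fls A B))) :=
    imp_of_eq ((fls_disj _).trans (app_congr_right P (condTerm_fls A B).symm))
  have himp : Prov Ax Δ (imp (disj p (app P B)) (app P (condTerm p A B))) := by
    simpa [inst] using inst_of_bool (Ax := Ax) (Δ := Δ)
      (M := imp (disj (var Ty.t 0) (app (shift Ty.t P) (shift Ty.t B)))
        (app (shift Ty.t P) (condTerm (var Ty.t 0) (shift Ty.t A) (shift Ty.t B)))) p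
      (by simpa [inst] using htru) (by simpa [inst] using hfls)
  exact mp himp hB

theorem app_of_eq_or_eq {P : Term C (α ⇒ Ty.t)} {A A₁ A₂ : Term C α}
    (h : Prov Ax Δ (disj (eq A A₁) (eq A A₂))) (h₁ : Prov Ax Δ (app P A₁))
    (h₂ : Prov Ax Δ (app P A₂)) : Prov Ax Δ (app P A) := by
  have ht := taut (Ax := Ax) (Δ := Δ) (.imp (.disj (.atom 0) (.atom 1))
    (.imp (.imp (.atom 0) (.iff (.atom 2) (.atom 3))) (.imp (.imp (.atom 1)
    (.iff (.atom 2) (.atom 4))) (.imp (.atom 3) (.imp (.atom 4) (.atom 2))))))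
    ![eq A A₁, eq A A₂, app P A, app P A₁, app P A₂]
  exact mp (mp (mp (mp (mp ht h) (leibniz P A A₁)) (leibniz P A A₂)) h₁) h₂

/-! ### Disjunctions of predicates -/

theorem app_disj₁ (P Q : Term C (α ⇒ Ty.t)) (A : Term C α) :
    Prov Ax Δ (eq (app (disj₁ P Q) A) (disj (app P A) (app Q A))) :=
  beta_of_inst_eq (by simp [inst])

theorem app_disj₂ (P Q : Term C (α ⇒ β ⇒ Ty.t)) (A : Term C α) :
    Prov Ax Δ (eq (app (disj₂ P Q) A) (disj₁ (app P A) (app Q A))) :=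
  beta_of_inst_eq (by simp [inst])

theorem app_app_disj₂ (P Q : Term C (α ⇒ β ⇒ Ty.t)) (A : Term C α) (B : Term C β) :
    Prov Ax Δ (eq (app (app (disj₂ P Q) A) B) (disj (app (app P A) B) (app (app Q A) B))) :=
  (app_congr_left (app_disj₂ P Q A) B).trans (app_disj₁ _ _ B)

theorem app_shift_disj₁ (P Q : Term C (α ⇒ Ty.t)) :
    Prov Ax Δ (eq (app (shift α (disj₁ P Q)) (var α 0))
      (disj (app (shift α P) (var α 0)) (app (shift α Q) (var α 0)))) := by
  rw [shift_disj₁]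
  exact app_disj₁ _ _ _

-- The rule for abstractions would ask for proofs from the shifted hypotheses; instead, `disj₁` is
-- expressed by the application of a closed term.
theorem disj₁_congr {P P' Q Q' : Term C (α ⇒ Ty.t)} (h : Prov Ax Δ (eq P P'))
    (h' : Prov Ax Δ (eq Q Q')) : Prov Ax Δ (eq (disj₁ P Q) (disj₁ P' Q')) := by
  let op : Term C ((α ⇒ Ty.t) ⇒ (α ⇒ Ty.t) ⇒ (α ⇒ Ty.t)) :=
    lam (α ⇒ Ty.t) (lam (α ⇒ Ty.t) (disj₁ (var (α ⇒ Ty.t) 1) (var (α ⇒ Ty.t) 0)))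
  have hop (R S : Term C (α ⇒ Ty.t)) : Prov Ax Δ (eq (app (app op R) S) (disj₁ R S)) :=
    (app_congr_left (beta _ R) S).trans (beta_of_inst_eq (by simp [inst]))
  exact (hop P Q).symm.trans ((app_congr (app_congr_right op h) h').trans (hop P' Q'))

theorem disj₁_assoc (P Q R : Term C (α ⇒ Ty.t)) :
    Prov Ax Δ (eq (disj₁ (disj₁ P Q) R) (disj₁ P (disj₁ Q R))) := by
  have hleft := (app_shift_disj₁ (Ax := Ax) (Δ := shift α '' Δ) (disj₁ P Q) R).trans
    (disj_congr (app_shift_disj₁ P Q) (refl _))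
  have hright := (app_shift_disj₁ (Ax := Ax) (Δ := shift α '' Δ) P (disj₁ Q R)).trans
    (disj_congr (refl _) (app_shift_disj₁ Q R))
  exact ext (hleft.trans ((disj_assoc _ _ _).trans hright.symm))

theorem fls_disj₁ (P : Term C (α ⇒ Ty.t)) : Prov Ax Δ (eq (disj₁ (lam α fls) P) P) :=
  ext ((app_shift_disj₁ _ P).trans ((disj_congr (beta_shift _) (refl _)).trans (fls_disj _)))

theorem disj₁_fls (P : Term C (α ⇒ Ty.t)) : Prov Ax Δ (eq (disj₁ P (lam α fls)) P) :=
  ext ((app_shift_disj₁ P _).trans ((disj_congr (refl _) (beta_shift _)).trans (disj_fls _)))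

theorem bigDisj_append : ∀ l l' : List (Term C (α ⇒ Ty.t)),
    Prov Ax Δ (eq (bigDisj (l ++ l')) (disj₁ (bigDisj l) (bigDisj l')))
  | [], _ => (fls_disj₁ _).symm
  | [_], [] => (disj₁_fls _).symm
  | [_], _ :: _ => refl _
  | P :: Q :: l, l' =>
      (disj₁_congr (refl P) (bigDisj_append (Q :: l) l')).trans (disj₁_assoc _ _ _).symm

end Prov

/-! ### Finite predicates -/

namespace Term

variable {n : ℕ} {C : Ty n → Type u} {C' : Ty n → Type v} {α : Ty n}

/-- The predicate of being equal to one of the terms `A¹, …, Aˡ`, that is, the disjunction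
`(= A¹) ∨ … ∨ (= Aˡ)` by which a pseudo-canonic representation enumerates the terms of a word. -/
def oneOf (l : List (Term C α)) : Term C (α ⇒ Ty.t) := bigDisj (l.map eqTo)

variable (f : (α : Ty n) → C α → C' α)

theorem mapCon_rename (ρ : Ty n → ℕ → ℕ) (A : Term C α) :
    mapCon f (rename ρ A) = rename ρ (mapCon f A) := by
  induction A generalizing ρ with
  | _ => simp_all [mapCon]

theorem mapCon_disj₁ (P Q : Term C (α ⇒ Ty.t)) :
    mapCon f (disj₁ P Q) = disj₁ (mapCon f P) (mapCon f Q) := by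
  simp only [disj₁, shift, ← mapCon_rename]
  rfl

theorem mapCon_eqTo (A : Term C α) : mapCon f (eqTo A) = eqTo (mapCon f A) := by
  simp only [eqTo, shift, ← mapCon_rename]
  rfl

theorem mapCon_bigDisj : ∀ l : List (Term C (α ⇒ Ty.t)),
    mapCon f (bigDisj l) = bigDisj (l.map (mapCon f))
  | [] => rfl
  | [_] => rfl
  | P :: Q :: l => (mapCon_disj₁ f P _).trans (congrArg _ (mapCon_bigDisj (Q :: l)))

theorem mapCon_oneOf (l : List (Term C α)) :
    mapCon f (oneOf l) = bigDisj (l.map fun A => eqTo (mapCon f A)) := by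
  simp [oneOf, mapCon_bigDisj, mapCon_eqTo, Function.comp_def]

end Term

namespace Prov

variable {n : ℕ} {C : Ty n → Type u} {Ax Δ : Set (Formula C)} {α : Ty n}

theorem app_eqTo (A B : Term C α) : Prov Ax Δ (eq (app (eqTo B) A) (eq A B)) :=
  beta_of_inst_eq (by simp [inst])

theorem oneOf_append (l l' : List (Term C α)) :
    Prov Ax Δ (eq (oneOf (l ++ l')) (disj₁ (oneOf l) (oneOf l'))) := by
  rw [oneOf, List.map_append]
  exact bigDisj_append _ _

theorem app_oneOf_nil (A : Term C α) : Prov Ax Δ (eq (app (oneOf []) A) fls) :=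
  beta_of_inst_eq (by simp [inst])

theorem app_oneOf_cons (A B : Term C α) (l : List (Term C α)) :
    Prov Ax Δ (eq (app (oneOf (B :: l)) A) (disj (eq A B) (app (oneOf l) A))) :=
  (app_congr_left (oneOf_append [B] l) A).trans
    ((app_disj₁ _ _ A).trans (disj_congr (app_eqTo A B) (refl _)))

theorem app_oneOf_of_mem {A : Term C α} {l : List (Term C α)} (h : A ∈ l) :
    Prov Ax Δ (app (oneOf l) A) := by
  induction h with
  | head l => exact eq_mpr (app_oneOf_cons A A l) (disj_inl _ (refl A))
  | tail B _ ih => exact eq_mpr (app_oneOf_cons A B _) (disj_inr _ ih)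

end Prov

/-! ### Languages -/

section Symbolic

variable {n N : ℕ} {B : Ty (n + 1) → Type u} {D : Ty (n + 1) → Type v} {α : Ty (n + 1)}

theorem LogicallyClosed.mem_of_provable_oneOf {L : Lang N B α} (hL : LogicallyClosed L)
    (hcons : Consistent (∅ : Set (Formula (SymCon N B)))) {w : List (Fin N)} :
    ∀ {l : List (Term (SymCon N B) α)} {A : Term (SymCon N B) α}, (∀ A' ∈ l, (w, A') ∈ L) →
      Provable ∅ (app (oneOf l) A) → (w, A) ∈ L
  | [], A, _, h => absurd (Prov.eq_mp (Prov.app_oneOf_nil A) h) hcons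
  | [A₁], A, hl, h =>
    have hA : Provable ∅ (eq A A₁) := Prov.eq_mp (Prov.app_eqTo A A₁) h
    hL w A A₁ A₁ (hl A₁ (by simp)) (hl A₁ (by simp)) (Prov.disj_inl _ hA)
  | A₁ :: A₂ :: l, A, hl, h => by
    have hcond : Provable ∅ (app (oneOf (A₂ :: l)) (condTerm (eq A A₁) A₂ A)) :=
      Prov.app_condTerm (Prov.app_oneOf_of_mem List.mem_cons_self)
        (Prov.eq_mp (Prov.app_oneOf_cons A A₁ _) h)
    have hmem : (w, condTerm (eq A A₁) A₂ A) ∈ L :=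
      hL.mem_of_provable_oneOf hcons (fun A' hA' => hl A' (List.mem_cons_of_mem _ hA')) hcond
    exact hL w A A₁ _ (hl A₁ (by simp)) hmem (Prov.or_eq_condTerm _ A₂ A)

variable {Δ : Set (Formula (SymCon N (fun β => B β ⊕ D β)))}
  {T TL TK : Term (SymCon N (fun β => B β ⊕ D β)) (Ty.s ⇒ α ⇒ Ty.t)} {L M : Lang N B α}
  {w : List (Fin N)} {A : Term (SymCon N B) α} {l l' : List (Term (SymCon N B) α)}

theorem Conservative.consistent_empty (hΔ : Conservative Δ) (hcons : Consistent Δ) :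
    Consistent (∅ : Set (Formula (SymCon N B))) :=
  fun h => hcons ((hΔ fls).1 h)

/-- The `α`-language of the pairs `(w, A)` with `Δ ⊢ T T_A(w) A`; it is the only language that
`(Δ, T)` can represent. -/
def provableLang (Δ : Set (Formula (SymCon N (fun β => B β ⊕ D β))))
    (T : Term (SymCon N (fun β => B β ⊕ D β)) (Ty.s ⇒ α ⇒ Ty.t)) : Lang N B α :=
  {p | Provable Δ (app (app T (wordT p.1)) (ext D p.2))}

theorem represents_iff : Represents Δ T L ↔ Consistent Δ ∧ L = provableLang Δ T := by
  simp [Represents, provableLang, Set.ext_iff]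

theorem Conservative.logicallyClosed_provableLang (hΔ : Conservative Δ) :
    LogicallyClosed (provableLang Δ T : Lang N B α) :=
  fun _ _ _ _ h₁ h₂ h => Prov.app_of_eq_or_eq ((hΔ _).1 h) h₁ h₂

theorem union_subset_provableLang_disj₂ :
    (provableLang Δ TL ∪ provableLang Δ TK : Lang N B α) ⊆ provableLang Δ (disj₂ TL TK) :=
  Set.union_subset (fun _ h => Prov.eq_mpr (Prov.app_app_disj₂ _ _ _ _) (Prov.disj_inl _ h))
    (fun _ h => Prov.eq_mpr (Prov.app_app_disj₂ _ _ _ _) (Prov.disj_inr _ h))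

/-- The terms of the word `w` are enumerated by the list `l`, in the sense of the first condition
on pseudo-canonic representations. The enumerating predicate is a term of the theory without `Δ`. -/
def Enumerates (Δ : Set (Formula (SymCon N (fun β => B β ⊕ D β))))
    (T : Term (SymCon N (fun β => B β ⊕ D β)) (Ty.s ⇒ α ⇒ Ty.t)) (w : List (Fin N))
    (l : List (Term (SymCon N B) α)) : Prop :=
  Provable Δ (eq (app T (wordT w)) (ext D (oneOf l)))

theorem pseudoCanonic_iff : PseudoCanonic Δ T L ↔
    Represents Δ T L ∧ (∀ w, ∃ l, Enumerates Δ T w l) ∧ Conservative Δ := by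
  simp only [PseudoCanonic, Enumerates, ext, mapCon_oneOf]

theorem Enumerates.disj₂ (hl : Enumerates Δ TL w l) (hl' : Enumerates Δ TK w l') :
    Enumerates Δ (disj₂ TL TK) w (l ++ l') := by
  have happend : Provable Δ (eq (ext D (oneOf (l ++ l')))
      (disj₁ (ext D (oneOf l)) (ext D (oneOf l')))) := by
    simp only [ext, mapCon_oneOf, List.map_append]
    exact Prov.bigDisj_append _ _
  exact (Prov.app_disj₂ _ _ _).trans ((Prov.disj₁_congr hl hl').trans happend.symm)

theorem Enumerates.mem_provableLang_iff (hl : Enumerates Δ T w l) (hΔ : Conservative Δ) :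
    (w, A) ∈ provableLang Δ T ↔ Provable ∅ (app (oneOf l) A) :=
  have h : Provable Δ (eq (app (app T (wordT w)) (ext D A)) (ext D (app (oneOf l) A))) :=
    Prov.app_congr_left hl _
  ⟨fun hA => (hΔ _).2 (Prov.eq_mp h hA), fun hA => Prov.eq_mpr h ((hΔ _).1 hA)⟩

theorem provableLang_disj₂_subset (hcons : Consistent Δ) (hΔ : Conservative Δ)
    (hTL : ∀ w, ∃ l, Enumerates Δ TL w l) (hTK : ∀ w, ∃ l, Enumerates Δ TK w l)
    (hM : LogicallyClosed M) (hLM : provableLang Δ TL ⊆ M) (hKM : provableLang Δ TK ⊆ M) :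
    provableLang Δ (disj₂ TL TK) ⊆ M := by
  rintro ⟨w, A⟩ hA
  obtain ⟨l, hl⟩ := hTL w
  obtain ⟨l', hl'⟩ := hTK w
  refine hM.mem_of_provable_oneOf (hΔ.consistent_empty hcons) (l := l ++ l') (fun A' hA' => ?_)
    (((hl.disj₂ hl').mem_provableLang_iff hΔ).1 hA)
  obtain h | h := List.mem_append.1 hA'
  · exact hLM ((hl.mem_provableLang_iff hΔ).2 (Prov.app_oneOf_of_mem h))
  · exact hKM ((hl'.mem_provableLang_iff hΔ).2 (Prov.app_oneOf_of_mem h))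

theorem logicalJoin_provableLang (hcons : Consistent Δ) (hΔ : Conservative Δ)
    (hTL : ∀ w, ∃ l, Enumerates Δ TL w l) (hTK : ∀ w, ∃ l, Enumerates Δ TK w l) :
    logicalJoin (provableLang Δ TL) (provableLang Δ TK) =
      (provableLang Δ (disj₂ TL TK) : Lang N B α) := by
  refine Set.Subset.antisymm (Set.sInter_subset_of_mem ⟨union_subset_provableLang_disj₂,
    hΔ.logicallyClosed_provableLang⟩) (Set.subset_sInter fun M hM => ?_)
  obtain ⟨hLM, hKM⟩ := Set.union_subset_iff.1 hM.1
  exact provableLang_disj₂_subset hcons hΔ hTL hTK hM.2 hLM hKM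

end Symbolic

end TyN

open TyN in
theorem proposition7p6 {n N : ℕ} {B : Ty (n + 1) → Type*} {D : Ty (n + 1) → Type*}
    {α : Ty (n + 1)}
    (L K : Lang N B α)
    (Δ : Set (Formula (SymCon N (fun β => B β ⊕ D β))))
    (TL TK : Term (SymCon N (fun β => B β ⊕ D β)) (Ty.s ⇒ α ⇒ Ty.t))
    (hL : PseudoCanonic Δ TL L) (hK : PseudoCanonic Δ TK K) :
    Represents Δ (Term.disj₂ TL TK) (logicalJoin L K) ∧
      PseudoCanonic Δ (Term.disj₂ TL TK) (logicalJoin L K) := by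
  rw [pseudoCanonic_iff] at hL hK
  obtain ⟨hL, hTL, hΔ⟩ := hL
  obtain ⟨hK, hTK, -⟩ := hK
  obtain ⟨hcons, rfl⟩ := represents_iff.1 hL
  obtain ⟨-, rfl⟩ := represents_iff.1 hK
  have hrep : Represents Δ (Term.disj₂ TL TK)
      (logicalJoin (provableLang Δ TL) (provableLang Δ TK)) :=
    represents_iff.2 ⟨hcons, logicalJoin_provableLang hcons hΔ hTL hTK⟩
  have henum (w : List (Fin N)) : ∃ l, Enumerates Δ (Term.disj₂ TL TK) w l := by
    obtain ⟨l, hl⟩ := hTL w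
    obtain ⟨l', hl'⟩ := hTK w
    exact ⟨l ++ l', hl.disj₂ hl'⟩
  exact ⟨hrep, pseudoCanonic_iff.2 ⟨hrep, henum, hΔ⟩⟩
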